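/- Fix a first-order planning domain $D$ (finitely many predicates and action schemas), a finite set $\Phi$ of Boolean and $\mathbb{N}$-valued features of the states of its instances, a sketch $R$ (a finite set of rules $C\mapsto E$ over $\Phi$), and $k\ge 1$. For a state $s$ of an instance, $G_R(s)$ is the set of states $s'$ that are goal states or for which the pair of feature valuations of $s,s'$ satisfies a rule of $R$. A problem has satisficing width $\le k$ if there are atom tuples $t_0,\dots,t_m$ of size at most $k$ such that $t_0$ is true initially, every optimal plan for $t_i$ extends by one action to an optimal plan for $t_{i+1}$ ($0\le i<m$), and the optimal plans for $t_m$ are plans for the problem (an admissible $k$-chain of length $m$). $G_R^k(s)$ is the set of states in $G_R(s)$ at most $m$ steps away from $s$, with $m$ the length of a shortest admissible $k$-chain for the problem of reaching $G_R(s)$ from $s$. Let $\mathcal Q$ be a class of solvable instances of $D$ that is closed, i.e. if $P\in\mathcal Q$ and $s$ is a state reachable in $P$ from which the goal can be reached, then $P$ with initial state $s$ is in $\mathcal Q$. Suppose that * the s-width of $R$ over $\mathcal Q$ is at most $k$: for every $P\in\mathcal Q$ with initial state $s$, the problem of reaching $G_R^k(s)$ from $s$ has satisficing width $\le k$, and $G_R^k(s)$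 contains no dead-end; * $R$ is state-acyclic in $\mathcal Q$: over no $P\in\mathcal Q$ is there a sequence of reachable states $s_0,\dots,s_n$ with $s_i$ not a goal state and $s_{i+1}\in G_R(s_i)$ for $i<n$, and $s_n=s_j$ for some $j<n$. Let $\mathrm{SIW}_R(k)$ be the algorithm that, starting with $s$ the initial state, repeatedly replaces $s$ by the first state of $G_R(s)$ found by a search $\mathrm{IW}(k)$ from $s$ (breadth-first search that prunes a newly generated state if it does not make a tuple of at most $k$ atoms true for the first time), until $s$ is a goal state. Then, for every order in which applicable actions are tried, $\mathrm{SIW}_R(k)$ halts with a plan on every $P\in\mathcal Q$. Moreover, for each $c$, if $P\in\mathcal Q$ has $N\ge 1$ ground atoms, branching factor at most $b\ge 1$, and each numerical feature takes at most $cN$ values on the reachable states of $P$, then it runs in $$O\bigl(bN^{|\Phi|+2k-1}\bigr)\ \text{time and}\ O\bigl(bN^k+N^{|\Phi|+k}\bigr)\ \text{space},$$ with constants that depend only on $D,\Phi,R,k,c$. Space is measured in stored search nodes, atom tuples and actions. Time is measured in elementary operations: generation of a successor state, removal of a node from the queue, lookup of an atom tuple among those seen so far, addition of an action to the plan, and evaluation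 of the features (with the goal and subgoal test) at one state. If $k\ge 2$ or $N\le b$, the time bound also holds when the last operation is charged any time of at most $cN$. -/

import Mathlib

namespace Planning

/-! ### Classical planning: first-order domains, instances, state models -/

/-- Atoms over a set `X` of terms: a predicate symbol applied to a tuple of terms. -/
abbrev AtomOver {Pred : Type} (arity : Pred → ℕ) (X : Type) : Type :=
  Σ p : Pred, (Fin (arity p) → X)

/-- An action schema with `params` parameters; the literals in its precondition and in its effect
are split into the positive and the negative ones. -/
structure ActionSchema {Pred : Type} (arity : Pred → ℕ) where
  params : ℕ
  prePos : List (AtomOver arity (Fin params))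
  preNeg : List (AtomOver arity (Fin params))
  effPos : List (AtomOver arity (Fin params))
  effNeg : List (AtomOver arity (Fin params))

/-- A first-order planning domain: finitely many predicates and finitely many action schemas. -/
structure Domain where
  Pred : Type
  [predFintype : Fintype Pred]
  [predDecEq : DecidableEq Pred]
  arity : Pred → ℕ
  Schema : Type
  [schemaFintype : Fintype Schema]
  [schemaDecEq : DecidableEq Schema]
  schema : Schema → ActionSchema arity

attribute [instance] Domain.predFintype Domain.predDecEq Domain.schemaFintype Domain.schemaDecEq

/-- All of a planning instance except its initial situation: the finite set of objects and the
goal literals (positive and negative). -/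
structure Task (D : Domain) where
  Obj : Type
  [objFintype : Fintype Obj]
  [objDecEq : DecidableEq Obj]
  goalPos : Finset (AtomOver D.arity Obj)
  goalNeg : Finset (AtomOver D.arity Obj)

attribute [instance] Task.objFintype Task.objDecEq

namespace Task

variable {D : Domain} (T : Task D)

/-- Ground atoms. -/
abbrev Atom : Type := AtomOver D.arity T.Obj

/-- The number `N` of ground atoms. -/
def numAtoms : ℕ := Fintype.card T.Atom

/-- A state is a truth valuation of the ground atoms, given by the set of the true ones. -/
abbrev State : Type := Finset T.Atom

/-- Ground actions: a schema with an object for every parameter. -/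
abbrev Act : Type := Σ a : D.Schema, (Fin (D.schema a).params → T.Obj)

/-- The ground atoms that a ground action yields from lifted atoms of its schema. -/
def ground (a : T.Act) (l : List (AtomOver D.arity (Fin (D.schema a.1).params))) :
    Finset T.Atom :=
  (l.map fun x => (⟨x.1, fun i => a.2 (x.2 i)⟩ : T.Atom)).toFinset

/-- The ground action `a` is applicable in `s`: its precondition literals are true in `s`. -/
def Applicable (s : T.State) (a : T.Act) : Prop :=
  T.ground a (D.schema a.1).prePos ⊆ s ∧ Disjoint (T.ground a (D.schema a.1).preNeg) s

/-- The successor state. -/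
def succ (s : T.State) (a : T.Act) : T.State :=
  (s \ T.ground a (D.schema a.1).effNeg) ∪ T.ground a (D.schema a.1).effPos

/-- The goal states. -/
def goalStates : Set T.State := {s | T.goalPos ⊆ s ∧ Disjoint T.goalNeg s}

open Classical in
/-- The state in which a sequence of actions executable in `s` ends (`none` if not executable). -/
noncomputable def exec : T.State → List T.Act → Option T.State
  | s, [] => some s
  | s, a :: π => if T.Applicable s a then exec (T.succ s a) π else none

/-- `π` is a plan from `s` for the set `G` of goal states. -/
def IsPlan (s : T.State) (G : Set T.State) (π : List T.Act) : Prop :=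
  ∃ s' ∈ G, T.exec s π = some s'

/-- `π` is an optimal (that is, shortest) plan from `s` for `G`. -/
def IsOptimalPlan (s : T.State) (G : Set T.State) (π : List T.Act) : Prop :=
  T.IsPlan s G π ∧ ∀ π', T.IsPlan s G π' → π.length ≤ π'.length

/-- `s'` is reachable from `s`. -/
def Reachable (s s' : T.State) : Prop := ∃ π, T.exec s π = some s'

/-- `s` is solvable; the other states are the dead-ends. -/
def Solvable (s : T.State) : Prop := ∃ π, T.IsPlan s T.goalStates π

/-- `b` bounds the branching factor of the part of the state model reachable from `s`. -/
def BranchingLE (s : T.State) (b : ℕ) : Prop :=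
  ∀ s', T.Reachable s s' → Set.ncard {a | T.Applicable s' a} ≤ b

/-! ### Satisficing width -/

/-- The states in which the atom tuple `t` is true. -/
def tupleStates (t : Finset T.Atom) : Set T.State := {s | t ⊆ s}

/-- `t 0, …, t m` is an admissible chain (from initial state `s`) of tuples of size at most `k`:
`t 0` is true in `s`, and every optimal plan for a tuple extends by one action to an optimal plan
for the next tuple. -/
def AdmissibleChain (s : T.State) (k m : ℕ) (t : ℕ → Finset T.Atom) : Prop :=
  (∀ i ≤ m, (t i).card ≤ k) ∧ t 0 ⊆ s ∧
  ∀ i < m, ∀ π, T.IsOptimalPlan s (T.tupleStates (t i)) π →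
    ∃ a, T.IsOptimalPlan s (T.tupleStates (t (i + 1))) (π ++ [a])

/-- `t 0, …, t m` is an admissible `k`-chain for the problem with initial state `s` and set `G` of
goal states: the optimal plans for `t m` are plans (not necessarily optimal) for the problem. -/
def AdmissibleChainFor (s : T.State) (G : Set T.State) (k m : ℕ) (t : ℕ → Finset T.Atom) :
    Prop :=
  T.AdmissibleChain s k m t ∧
  ∀ π, T.IsOptimalPlan s (T.tupleStates (t m)) π → T.IsPlan s G π

/-- The problem with initial state `s` and goal states `G` has satisficing width at most `k`. -/
def SWidthLE (s : T.State) (G : Set T.State) (k : ℕ) : Prop :=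
  ∃ m t, T.AdmissibleChainFor s G k m t

/-- The length `m` of a shortest admissible `k`-chain for the problem `(s, G)`. -/
noncomputable def shortestChain (s : T.State) (G : Set T.State) (k : ℕ) : ℕ :=
  sInf {m | ∃ t, T.AdmissibleChainFor s G k m t}

end Task

/-- A planning instance over the domain `D`. -/
structure Instance (D : Domain) where
  task : Task D
  start : task.State

/-- The class `Q` is closed: with an instance it contains every instance that differs from it only
in the initial state, if that state is reachable in the instance and not a dead-end. -/
def ClosedClass {D : Domain} (Q : Set (Instance D)) : Prop :=
  ∀ P ∈ Q, ∀ s, P.task.Reachable P.start s → P.task.Solvable s → (⟨P.task, s⟩ : Instance D) ∈ Q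

/-! ### Features and sketches -/

/-- A finite set of Boolean and numerical features over the states of the instances of `D`. -/
structure Features (D : Domain) where
  BoolF : Type
  NumF : Type
  [boolFintype : Fintype BoolF]
  [numFintype : Fintype NumF]
  bval : BoolF → (T : Task D) → T.State → Bool
  nval : NumF → (T : Task D) → T.State → ℕ

attribute [instance] Features.boolFintype Features.numFintype

/-- The number of features. -/
def Features.card {D : Domain} (Φ : Features D) : ℕ := Fintype.card Φ.BoolF + Fintype.card Φ.NumF

/-- In the instance `P`, every numerical feature has at most `c * N` values on the reachable
states. (Boolean features have at most two values.) -/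
def Features.LinearlyManyValues {D : Domain} (Φ : Features D) (c : ℕ) (P : Instance D) : Prop :=
  ∀ n : Φ.NumF, (Φ.nval n P.task '' {s | P.task.Reachable P.start s}).encard
    ≤ ((c * P.task.numAtoms : ℕ) : ℕ∞)

/-- Feature conditions `p`, `¬p`, `n = 0`, `n > 0`. -/
inductive Condition {D : Domain} (Φ : Features D) where
  | pos (p : Φ.BoolF)
  | neg (p : Φ.BoolF)
  | eqZero (n : Φ.NumF)
  | gtZero (n : Φ.NumF)

/-- Feature effects `p`, `¬p`, `p?`, `n↓`, `n↑`, `n?`. -/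
inductive Effect {D : Domain} (Φ : Features D) where
  | pos (p : Φ.BoolF)
  | neg (p : Φ.BoolF)
  | unkBool (p : Φ.BoolF)
  | dec (n : Φ.NumF)
  | inc (n : Φ.NumF)
  | unkNum (n : Φ.NumF)

/-- A sketch rule `C ↦ E`. -/
structure Rule {D : Domain} (Φ : Features D) where
  C : List (Condition Φ)
  E : List (Effect Φ)

/-- A sketch: a finite collection of rules. -/
abbrev Sketch {D : Domain} (Φ : Features D) : Type := List (Rule Φ)

section sketch

variable {D : Domain} {Φ : Features D}

/-- Truth of a feature condition in the feature valuation of `s`. -/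
def Condition.Holds (T : Task D) (s : T.State) : Condition Φ → Prop
  | .pos p => Φ.bval p T s = true
  | .neg p => Φ.bval p T s = false
  | .eqZero n => Φ.nval n T s = 0
  | .gtZero n => 0 < Φ.nval n T s

/-- The effect is satisfied by the feature valuations of `s` and `s'`. -/
def Effect.Holds (T : Task D) (s s' : T.State) : Effect Φ → Prop
  | .pos p => Φ.bval p T s' = true
  | .neg p => Φ.bval p T s' = false
  | .unkBool _ => True
  | .dec n => Φ.nval n T s' < Φ.nval n T s
  | .inc n => Φ.nval n T s < Φ.nval n T s'
  | .unkNum _ => True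

/-- The pair of feature valuations of `(s, s')` satisfies the rule: the condition is true in `s`,
the effects are satisfied, and features that do not occur in the effects keep their value. -/
def Rule.Satisfied (r : Rule Φ) (T : Task D) (s s' : T.State) : Prop :=
  (∀ x ∈ r.C, x.Holds T s) ∧ (∀ x ∈ r.E, x.Holds T s s') ∧
  (∀ p, Effect.pos p ∉ r.E → Effect.neg p ∉ r.E → Effect.unkBool p ∉ r.E →
    Φ.bval p T s' = Φ.bval p T s) ∧
  (∀ n, Effect.dec n ∉ r.E → Effect.inc n ∉ r.E → Effect.unkNum n ∉ r.E →
    Φ.nval n T s' = Φ.nval n T s)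

/-- The set `G_R(s)` of subgoal states. -/
def subgoals (R : Sketch Φ) (T : Task D) (s : T.State) : Set T.State :=
  {s' | s' ∈ T.goalStates ∨ ∃ r ∈ R, r.Satisfied T s s'}

/-- The set `G_R^k(s)`: the states of `G_R(s)` at most `m` steps away from `s`, with `m` the length
of a shortest admissible `k`-chain for the problem of reaching `G_R(s)` from `s`. -/
def nearSubgoals (R : Sketch Φ) (k : ℕ) (T : Task D) (s : T.State) : Set T.State :=
  {s' ∈ subgoals R T s |
    ∃ π, T.exec s π = some s' ∧ π.length ≤ T.shortestChain s (subgoals R T s) k}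

/-- The s-width of the sketch `R` over the class `Q` is bounded by `k`. -/
def SketchSWidthLE (R : Sketch Φ) (Q : Set (Instance D)) (k : ℕ) : Prop :=
  ∀ P ∈ Q, P.task.SWidthLE P.start (nearSubgoals R k P.task P.start) k ∧
    ∀ s' ∈ nearSubgoals R k P.task P.start, P.task.Solvable s'

/-- The sketch is state acyclic in `Q`: over no instance in `Q` is there a sequence
`s 0, …, s n` of (reachable) states with `s (i+1) ∈ G_R(s i)` and `s n = s j` for some `j < n`.
A sequence ends when it reaches a goal state; every goal state `g` is in `G_R(g)`. -/
def StateAcyclic (R : Sketch Φ) (Q : Set (Instance D)) : Prop :=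
  ∀ P ∈ Q, ¬ ∃ (n : ℕ) (s : ℕ → P.task.State),
    (∀ i ≤ n, P.task.Reachable P.start (s i)) ∧
    (∀ i < n, s i ∉ P.task.goalStates) ∧
    (∀ i < n, s (i + 1) ∈ subgoals R P.task (s i)) ∧
    ∃ j < n, s n = s j

end sketch

/-! ### The algorithm `SIW_R(k)` with its time and space -/

section algorithm

variable {D : Domain}

/-- A search node: its state, and the actions (last one first) from the root of the search to it.
The list extends the list of the parent node by one entry, so it is stored as one action and a
pointer to the parent. -/
structure Node (T : Task D) where
  state : T.State
  path : List T.Act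

/-- Configurations of `SIW_R(k)`.
* `start plan s`: the actions `plan` led from the initial state to `s`; an `IW(k)` search from `s`
  is about to start;
* `search plan root table closed queue todo`: the `IW(k)` search from `root` is running; `table`
  holds the tuples made true so far, `closed` the expanded nodes, `queue` the nodes still to be
  expanded; the first one is being expanded, and `todo` are its actions that remain;
* `done plan`: halted with answer `plan`;
* `fail`: halted without an answer. -/
inductive Config (T : Task D) where
  | start (plan : List T.Act) (s : T.State)
  | search (plan : List T.Act) (root : T.State) (table : Finset (Finset T.Atom))
      (closed queue : List (Node T)) (todo : List T.Act)
  | done (plan : List T.Act)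
  | fail

/-- The tuples of at most `k` atoms that are true in `s`. -/
def tuples (T : Task D) (k : ℕ) (s : T.State) : Finset (Finset T.Atom) :=
  s.powerset.filter fun t => t.card ≤ k

/-- The tuples of at most `k` atoms that are true in `s'` and not in its parent `s`. These are the
ones to be looked up when `s'` is generated, since those true in `s` are in the table already. -/
def newTuples (T : Task D) (k : ℕ) (s s' : T.State) : Finset (Finset T.Atom) :=
  (tuples T k s').filter fun t => ¬ t ⊆ s

/-- An order in which the applicable actions of each state are tried. -/
def IsActionOrder (T : Task D) (order : T.State → List T.Act) : Prop :=
  ∀ s, (order s).Nodup ∧ ∀ a, a ∈ order s ↔ T.Applicable s a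

open Classical in
/-- One transition of `SIW_R(k)`; `G s` is the set of subgoal states of `s`. The search from `root`
is breadth-first; a newly generated state is pruned if it makes no tuple of at most `k` atoms true
for the first time, and otherwise the search ends if it is in `G root`. -/
noncomputable def step (T : Task D) (k : ℕ) (G : T.State → Set T.State)
    (order : T.State → List T.Act) : Config T → Config T
  | .start plan s =>
      if s ∈ T.goalStates then .done plan
      else if s ∈ G s then .start plan s
      else .search plan s (tuples T k s) [] [⟨s, []⟩] (order s)
  | .search _ _ _ _ [] _ => .fail
  | .search plan root table closed (x :: queue) [] =>
      .search plan root table (x :: closed) queue ((queue.head?.map fun y => order y.state).getD [])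
  | .search plan root table closed (x :: queue) (a :: todo) =>
      let s' := T.succ x.state a
      if newTuples T k x.state s' ⊆ table then
        .search plan root table closed (x :: queue) todo
      else if s' ∈ G root then .start (plan ++ (a :: x.path).reverse) s'
      else
        .search plan root (table ∪ newTuples T k x.state s') closed
          (x :: (queue ++ [⟨s', a :: x.path⟩])) todo
  | .done plan => .done plan
  | .fail => .fail

open Classical in
/-- The time of one transition: one unit for the generation of a state, for every tuple that is
looked up (and possibly inserted) in the table, for the removal of a node from the queue, and for
every action copied to the plan; and `e s` units for computing the features of `s` and testing
whether `s` is a goal or subgoal state. -/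
noncomputable def stepTime (T : Task D) (k : ℕ) (G : T.State → Set T.State) (e : T.State → ℕ) :
    Config T → ℕ
  | .start _ s => 1 + e s + (tuples T k s).card
  | .search _ _ _ _ [] _ => 1
  | .search _ _ _ _ (_ :: _) [] => 1
  | .search _ root table _ (x :: _) (a :: _) =>
      let s' := T.succ x.state a
      1 + (newTuples T k x.state s').card +
        if newTuples T k x.state s' ⊆ table then 0
        else e s' + if s' ∈ G root then (a :: x.path).length else 0
  | .done _ => 0
  | .fail => 0

/-- The space of a configuration: one unit for every stored node, tuple and action. -/
def space (T : Task D) : Config T → ℕ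
  | .start plan _ => plan.length + 1
  | .search plan _ table closed queue todo =>
      plan.length + 1 + table.card + closed.length + queue.length + todo.length
  | .done plan => plan.length
  | .fail => 0

variable {Φ : Features D}

/-- The configuration of `SIW_R(k)` on the instance `P` after `n` transitions. -/
noncomputable def siw (R : Sketch Φ) (k : ℕ) (P : Instance D)
    (order : P.task.State → List P.task.Act) (n : ℕ) : Config P.task :=
  (step P.task k (subgoals R P.task) order)^[n] (.start [] P.start)

/-- The time that `SIW_R(k)` needs for its first `n` transitions on `P`. -/
noncomputable def siwTime (R : Sketch Φ) (k : ℕ) (P : Instance D)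
    (order : P.task.State → List P.task.Act) (e : P.task.State → ℕ) (n : ℕ) : ℕ :=
  ∑ i ∈ Finset.range n, stepTime P.task k (subgoals R P.task) e (siw R k P order i)

end algorithm

end Planning

namespace Planning

/-! ### Executions and admissible chains -/

namespace Task

variable {D : Domain} (T : Task D)

/-! Novelty pruning in breadth-first order cannot lose an admissible chain. Suppose a kept node is
reached by an optimal plan for `t i`. By admissibility some action extends this plan to an optimal
one for `t (i + 1)`. If the resulting child is pruned, the tuple `t (i + 1)` is already true in a
kept node, which is no deeper than the child because the search proceeds by levels; so that node's
path is optimal for `t (i + 1)` as well. The chain condition speaks of every optimal plan, so the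
argument continues from there, and the last tuple yields a subgoal state
(`AdmissibleChainFor.exists_goal`, `SearchInv.exists_mem_queue`).

Hence a search from `s` returns a subgoal at depth at most `m`, the length of a shortest chain. The
returned state therefore lies in `G_R^k(s)` and is not a dead-end, and closedness of `Q` makes the
width hypothesis available for the next search (`HasTrace.exists_succ`).

The number of searches is bounded by the number of feature valuations: apart from goal states,
membership in `G_R(s)` depends only on valuations, so two non-goal states with equal valuation in
one run could be glued to a cycle, against acyclicity (`IsSubgoalSeq.injOn_valuation`). This gives
`O(N^|Φ|)` searches.

In one search every kept node contributes a fresh tuple, so `O(N^k)` nodes are kept, each with at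
most `b` children. An action adds boundedly many atoms, so a child has only `O(N^(k-1))` new tuples
to look up (`card_newTuples_succ_le`). Thus a search takes time `O(b N^(2k-1))`; a potential
function does the accounting (`SearchInv.step`). -/

theorem exec_append (s : T.State) (π₁ π₂ : List T.Act) :
    T.exec s (π₁ ++ π₂) = (T.exec s π₁).bind fun s' => T.exec s' π₂ := by
  induction π₁ generalizing s with
  | nil => simp [exec]
  | cons a π ih =>
    simp only [List.cons_append, exec]
    split_ifs <;> simp [ih]

variable {T}

theorem exec_concat {s s' : T.State} {π : List T.Act} {a : T.Act} (h : T.exec s π = some s')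
    (ha : T.Applicable s' a) : T.exec s (π ++ [a]) = some (T.succ s' a) := by
  simp [exec_append, h, exec, ha]

theorem exists_of_exec_concat {s s'' : T.State} {π : List T.Act} {a : T.Act}
    (h : T.exec s (π ++ [a]) = some s'') :
    ∃ s', T.exec s π = some s' ∧ T.Applicable s' a ∧ s'' = T.succ s' a := by
  rw [exec_append] at h
  obtain ⟨s', h1, h2⟩ := Option.bind_eq_some_iff.1 h
  by_cases ha : T.Applicable s' a
  · exact ⟨s', h1, ha, by simpa [exec, ha, eq_comm] using h2⟩
  · simp [exec, ha] at h2

theorem exec_trans {s s' s'' : T.State} {π₁ π₂ : List T.Act} (h₁ : T.exec s π₁ = some s')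
    (h₂ : T.exec s' π₂ = some s'') : T.exec s (π₁ ++ π₂) = some s'' := by
  simp [exec_append, h₁, h₂]

theorem Reachable.refl (s : T.State) : T.Reachable s s := ⟨[], by simp [exec]⟩

theorem Reachable.trans {s s' s'' : T.State} (h₁ : T.Reachable s s') (h₂ : T.Reachable s' s'') :
    T.Reachable s s'' := by
  obtain ⟨π₁, h₁⟩ := h₁
  obtain ⟨π₂, h₂⟩ := h₂
  exact ⟨_, exec_trans h₁ h₂⟩

/-- If the visited plans `V` contain the empty one, and whenever a visited plan of length less
than `m` extends by an action, every small tuple that becomes true is true after a visited plan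
that is not longer, then a goal state is visited. -/
theorem AdmissibleChainFor.exists_goal {s : T.State} {G : Set T.State} {k m : ℕ}
    {t : ℕ → Finset T.Atom} (h : T.AdmissibleChainFor s G k m t)
    (V : List T.Act → T.State → Prop) (hV : ∀ π s', V π s' → T.exec s π = some s')
    (h0 : V [] s)
    (hstep : ∀ π s' a, V π s' → π.length < m → T.Applicable s' a →
      ∀ u : Finset T.Atom, u.card ≤ k → u ⊆ T.succ s' a →
        ∃ π' s'', V π' s'' ∧ u ⊆ s'' ∧ π'.length ≤ π.length + 1) :
    ∃ π s', V π s' ∧ s' ∈ G := by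
  have key : ∀ i ≤ m, ∃ π s', V π s' ∧ T.IsOptimalPlan s (T.tupleStates (t i)) π ∧
      π.length = i := by
    intro i
    induction i with
    | zero =>
      exact fun _ => ⟨[], s, h0, ⟨⟨s, h.1.2.1, hV _ _ h0⟩, fun _ _ => Nat.zero_le _⟩, rfl⟩
    | succ i ih =>
      intro hi
      obtain ⟨π, s', hv, hopt, hlen⟩ := ih (by omega)
      obtain ⟨a, hopt'⟩ := h.1.2.2 i (by omega) π hopt
      obtain ⟨s₂, hs₂, hex⟩ := hopt'.1
      obtain ⟨s₁, hs₁, ha, rfl⟩ := exists_of_exec_concat hex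
      obtain rfl : s' = s₁ := by simpa [hV _ _ hv] using hs₁
      -- The visited plan `π'` may differ from `π ++ [a]`. It is not longer, and optimality of `π ++
      -- [a]` forbids shorter, so it is optimal too and has length exactly `i + 1`.
      obtain ⟨π', s'', hv', hu, hl⟩ := hstep π s' a hv (by omega) ha _ (h.1.1 _ hi) hs₂
      have hp : T.IsPlan s (T.tupleStates (t (i + 1))) π' := ⟨s'', hu, hV _ _ hv'⟩
      have hge := hopt'.2 _ hp
      rw [List.length_append, List.length_singleton] at hge
      refine ⟨π', s'', hv', ⟨hp, fun π'' hp' => ?_⟩, by omega⟩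
      have := hopt'.2 _ hp'
      rw [List.length_append, List.length_singleton] at this
      omega
  obtain ⟨π, s', hv, hopt, -⟩ := key m le_rfl
  obtain ⟨g, hg, hex⟩ := h.2 π hopt
  obtain rfl : s' = g := by simpa [hV _ _ hv] using hex
  exact ⟨π, s', hv, hg⟩

theorem AdmissibleChainFor.mono {s : T.State} {G G' : Set T.State} {k m : ℕ}
    {t : ℕ → Finset T.Atom} (h : T.AdmissibleChainFor s G k m t) (hG : G ⊆ G') :
    T.AdmissibleChainFor s G' k m t :=
  ⟨h.1, fun π hπ => let ⟨s', hs', he⟩ := h.2 π hπ; ⟨s', hG hs', he⟩⟩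

/-- Width is assumed for the near subgoals, while the search tests for all subgoals. Enlarging the
goal set keeps a chain admissible, so the infimum defining `shortestChain` is over a nonempty set
and is attained. -/
theorem SWidthLE.exists_shortest {s : T.State} {G G' : Set T.State} {k : ℕ}
    (h : T.SWidthLE s G k) (hG : G ⊆ G') :
    ∃ t, T.AdmissibleChainFor s G' k (T.shortestChain s G' k) t := by
  obtain ⟨m, t, ht⟩ := h
  exact Nat.sInf_mem (s := {m | ∃ t, T.AdmissibleChainFor s G' k m t}) ⟨m, t, ht.mono hG⟩

end Task

/-! ### Counting atom tuples -/

section counting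

variable {D : Domain} (T : Task D)

/-- All tuples of at most `k` ground atoms. -/
abbrev allTuples (k : ℕ) : Finset (Finset T.Atom) := tuples T k Finset.univ

variable {T}

theorem mem_tuples {k : ℕ} {s : T.State} {t : Finset T.Atom} :
    t ∈ tuples T k s ↔ t ⊆ s ∧ t.card ≤ k := by
  simp [tuples]

theorem mem_newTuples {k : ℕ} {s s' : T.State} {t : Finset T.Atom} :
    t ∈ newTuples T k s s' ↔ (t ⊆ s' ∧ t.card ≤ k) ∧ ¬ t ⊆ s := by
  simp [newTuples, tuples]

theorem tuples_subset_allTuples (k : ℕ) (s : T.State) : tuples T k s ⊆ allTuples T k := by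
  intro t ht
  rw [mem_tuples] at ht ⊢
  exact ⟨Finset.subset_univ _, ht.2⟩

theorem newTuples_subset_tuples (k : ℕ) (s s' : T.State) :
    newTuples T k s s' ⊆ tuples T k s' := Finset.filter_subset _ _

theorem empty_mem_tuples (k : ℕ) (s : T.State) : ∅ ∈ tuples T k s := by
  simp [mem_tuples]

variable (T) in
theorem card_allTuples_le (k : ℕ) : (allTuples T k).card ≤ (T.numAtoms + 1) ^ k := by
  induction k with
  | zero =>
    have : allTuples T 0 ⊆ {∅} := by
      intro t ht
      simpa using (mem_tuples.1 ht).2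
    simpa using Finset.card_le_card this
  | succ k ih =>
    have hsub : allTuples T (k + 1) ⊆ allTuples T k ∪
        ((Finset.univ : Finset T.Atom) ×ˢ allTuples T k).image fun q => insert q.1 q.2 := by
      intro t ht
      have ht := (mem_tuples.1 ht).2
      rw [Finset.mem_union]
      rcases t.eq_empty_or_nonempty with rfl | ⟨p, hp⟩
      · exact Or.inl (empty_mem_tuples _ _)
      · refine Or.inr (Finset.mem_image.2 ⟨(p, t.erase p), ?_, Finset.insert_erase hp⟩)
        simp only [Finset.mem_product, Finset.mem_univ, true_and, mem_tuples,
          Finset.subset_univ, Finset.card_erase_of_mem hp]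
        omega
    calc (allTuples T (k + 1)).card ≤ _ := Finset.card_le_card hsub
      _ ≤ (allTuples T k).card + T.numAtoms * (allTuples T k).card := by
          refine (Finset.card_union_le _ _).trans (Nat.add_le_add_left ?_ _)
          refine Finset.card_image_le.trans ?_
          rw [Finset.card_product]
          rfl
      _ = (allTuples T k).card * (T.numAtoms + 1) := by ring
      _ ≤ (T.numAtoms + 1) ^ k * (T.numAtoms + 1) := Nat.mul_le_mul_right _ ih
      _ = (T.numAtoms + 1) ^ (k + 1) := (pow_succ _ _).symm

/-- The number of positive effect literals in the action schemas of a domain. -/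
def effectSize (D : Domain) : ℕ := ∑ a : D.Schema, (D.schema a).effPos.length

theorem card_ground_effPos_le (a : T.Act) :
    (T.ground a (D.schema a.1).effPos).card ≤ effectSize D := by
  refine (List.toFinset_card_le _).trans ?_
  rw [List.length_map]
  exact Finset.single_le_sum (f := fun a : D.Schema => (D.schema a).effPos.length)
    (fun _ _ => Nat.zero_le _) (Finset.mem_univ a.1)

/-- A new tuple contains an atom that was false before, hence one added by a positive effect; the
other atoms form a tuple of size at most `k - 1`. This saves a factor `N` over looking up all true
tuples. -/
theorem card_newTuples_succ_le (k : ℕ) (s : T.State) (a : T.Act) :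
    (newTuples T k s (T.succ s a)).card ≤ effectSize D * (T.numAtoms + 1) ^ (k - 1) := by
  have hsub : newTuples T k s (T.succ s a) ⊆
      (T.ground a (D.schema a.1).effPos ×ˢ allTuples T (k - 1)).image
        fun q => insert q.1 q.2 := by
    intro t ht
    obtain ⟨⟨h1, h2⟩, h3⟩ := mem_newTuples.1 ht
    obtain ⟨p, hp, hps⟩ := Finset.not_subset.1 h3
    refine Finset.mem_image.2 ⟨(p, t.erase p), ?_, Finset.insert_erase hp⟩
    have hp' := h1 hp
    simp only [Task.succ, Finset.mem_union, Finset.mem_sdiff, hps, false_and, false_or] at hp'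
    simp only [Finset.mem_product, mem_tuples, Finset.subset_univ, true_and,
      Finset.card_erase_of_mem hp]
    exact ⟨hp', by omega⟩
  refine (Finset.card_le_card hsub).trans (Finset.card_image_le.trans ?_)
  rw [Finset.card_product]
  exact Nat.mul_le_mul (card_ground_effPos_le a) (card_allTuples_le T (k - 1))

end counting

end Planning

namespace Planning

/-! ### Correctness and cost of a single `IW(k)` search -/

section search

variable {D : Domain} {T : Task D}

/-- Every small tuple that the action `a` makes true after `y` is true in one of the `nodes` at
most one step deeper than `y`. -/
def Covered (k : ℕ) (nodes : List (Node T)) (y : Node T) (a : T.Act) : Prop :=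
  ∀ t ∈ tuples T k (T.succ y.state a),
    ∃ z ∈ nodes, t ⊆ z.state ∧ z.path.length ≤ y.path.length + 1

theorem Covered.mono {k : ℕ} {l l' : List (Node T)} {y : Node T} {a : T.Act}
    (h : Covered k l y a) (hl : l ⊆ l') : Covered k l' y a := fun t ht =>
  let ⟨z, hz, h'⟩ := h t ht
  ⟨z, hl hz, h'⟩

/-- The invariant of an `IW(k)` search from `root` for a state in `Gr`. -/
structure SearchInv (k : ℕ) (Gr : Set T.State) (order : T.State → List T.Act) (root : T.State)
    (table : Finset (Finset T.Atom)) (closed queue : List (Node T)) (todo : List T.Act) :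
    Prop where
  root_mem : ⟨root, []⟩ ∈ closed ++ queue
  valid : ∀ x ∈ closed ++ queue, T.exec root x.path.reverse = some x.state
  notMem : ∀ x ∈ closed ++ queue, x.state ∉ Gr
  tuples_subset : ∀ x ∈ closed ++ queue, tuples T k x.state ⊆ table
  table_subset : table ⊆ allTuples T k
  exists_of_mem_table : ∀ t ∈ table, ∃ z ∈ closed ++ queue, t ⊆ z.state
  sorted : (closed.reverse ++ queue).Pairwise fun x y => x.path.length ≤ y.path.length
  length_le_head : ∀ x ∈ queue.head?, ∀ y ∈ queue, y.path.length ≤ x.path.length + 1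
  expanded : ∀ y ∈ closed, ∀ a, T.Applicable y.state a → Covered k (closed ++ queue) y a
  expanded_head : ∀ x ∈ queue.head?, ∀ a, T.Applicable x.state a → a ∉ todo →
    Covered k (closed ++ queue) x a
  todo_suffix : todo <:+ (queue.head?.map fun y => order y.state).getD []
  path_length_lt : ∀ x ∈ closed ++ queue, x.path.length < closed.length + queue.length
  length_le_card : closed.length + queue.length ≤ table.card

theorem searchInv_init {k : ℕ} {Gr : Set T.State} {order : T.State → List T.Act}
    (horder : IsActionOrder T order) {root : T.State} (hroot : root ∉ Gr) :
    SearchInv k Gr order root (tuples T k root) [] [⟨root, []⟩] (order root) where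
  root_mem := by simp
  valid := by simp [Task.exec]
  notMem := by simpa using hroot
  tuples_subset := by simp
  table_subset := tuples_subset_allTuples _ _
  exists_of_mem_table t ht := ⟨⟨root, []⟩, by simp, (mem_tuples.1 ht).1⟩
  sorted := by simp
  length_le_head := by simp
  expanded := by simp
  expanded_head := by
    intro x hx a ha hna
    obtain rfl : ⟨root, []⟩ = x := by simpa using hx
    exact absurd (((horder _).2 a).2 ha) hna
  todo_suffix := by simp
  path_length_lt := by simp
  -- The empty tuple is always in the table and accounts for the root.
  length_le_card := by
    simpa using Finset.card_pos.2 ⟨∅, empty_mem_tuples k root⟩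

namespace SearchInv

variable {k : ℕ} {Gr : Set T.State} {order : T.State → List T.Act} {root : T.State}
  {table : Finset (Finset T.Atom)} {closed queue : List (Node T)} {todo : List T.Act}

/-- While the search runs, some node at a depth less than that of the goal is not expanded. -/
theorem exists_mem_queue (inv : SearchInv k Gr order root table closed queue todo) {m : ℕ}
    {t : ℕ → Finset T.Atom} (ht : T.AdmissibleChainFor root Gr k m t) :
    ∃ y ∈ queue, y.path.length < m := by
  -- If all queued nodes had depth at least `m`, every node at smaller depth would be expanded, so
  -- the paths of all nodes would qualify as visited plans and one node would be a subgoal,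
  -- contradicting `notMem`.
  by_contra! hq
  obtain ⟨π, s', ⟨x, hx, rfl, rfl⟩, hs'⟩ := ht.exists_goal
    (fun π s' => ∃ x ∈ closed ++ queue, x.path.reverse = π ∧ x.state = s')
    (by rintro _ _ ⟨x, hx, rfl, rfl⟩; exact inv.valid x hx)
    ⟨_, inv.root_mem, rfl, rfl⟩
    (by
      rintro _ _ a ⟨x, hx, rfl, rfl⟩ hlt ha u hu hus
      rw [List.length_reverse] at hlt ⊢
      have hxc : x ∈ closed := by
        rcases List.mem_append.1 hx with h | h
        · exact h
        · exact absurd (hq x h) (by omega)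
      obtain ⟨z, hz, huz, hl⟩ := inv.expanded x hxc a ha u (mem_tuples.2 ⟨hus, hu⟩)
      exact ⟨_, _, ⟨z, hz, rfl, rfl⟩, huz, by simpa using hl⟩)
  exact inv.notMem x hx hs'

theorem head_le {x : Node T} (inv : SearchInv k Gr order root table closed (x :: queue) todo) :
    ∀ y ∈ x :: queue, x.path.length ≤ y.path.length := by
  have h := (List.pairwise_append.1 inv.sorted).2.1
  intro y hy
  rcases List.mem_cons.1 hy with rfl | hy
  · exact le_rfl
  · exact (List.pairwise_cons.1 h).1 y hy

theorem head_length_lt {x : Node T}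
    (inv : SearchInv k Gr order root table closed (x :: queue) todo) {m : ℕ}
    {t : ℕ → Finset T.Atom} (ht : T.AdmissibleChainFor root Gr k m t) : x.path.length < m := by
  obtain ⟨y, hy, hlt⟩ := inv.exists_mem_queue ht
  exact (inv.head_le y hy).trans_lt hlt

/-- The breadth-first property that makes pruning harmless: whichever node made a tuple true
earlier, it is no deeper than a child of the node in expansion. -/
theorem length_le_succ {x : Node T}
    (inv : SearchInv k Gr order root table closed (x :: queue) todo) :
    ∀ z ∈ closed ++ x :: queue, z.path.length ≤ x.path.length + 1 := by
  intro z hz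
  rcases List.mem_append.1 hz with h | h
  · have := (List.pairwise_append.1 inv.sorted).2.2 z (by simpa using h) x (by simp)
    omega
  · exact inv.length_le_head x (by simp) z h

theorem close (horder : IsActionOrder T order) {x : Node T}
    (inv : SearchInv k Gr order root table closed (x :: queue) []) :
    SearchInv k Gr order root table (x :: closed) queue
      ((queue.head?.map fun y => order y.state).getD []) := by
  have hmem : ∀ z, z ∈ (x :: closed) ++ queue ↔ z ∈ closed ++ x :: queue := by
    intro z
    simp only [List.mem_append, List.mem_cons]
    tauto
  have hsub : closed ++ x :: queue ⊆ (x :: closed) ++ queue := fun z hz => (hmem z).2 hz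
  have hlen : (x :: closed).length + queue.length = closed.length + (x :: queue).length := by
    simp only [List.length_cons]
    omega
  refine ⟨(hmem _).2 inv.root_mem, fun z hz => inv.valid z ((hmem z).1 hz),
    fun z hz => inv.notMem z ((hmem z).1 hz), fun z hz => inv.tuples_subset z ((hmem z).1 hz),
    inv.table_subset, fun t ht => ?_, ?_, fun y hy z hz => ?_, fun y hy a ha => ?_,
    fun y hy a ha hna => ?_, List.suffix_refl _, fun z hz => ?_, ?_⟩
  · obtain ⟨z, hz, h⟩ := inv.exists_of_mem_table t ht
    exact ⟨z, hsub hz, h⟩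
  · simpa using inv.sorted
  · have h1 := inv.length_le_head x (by simp) z (by simp [hz])
    have h2 := inv.head_le y (List.mem_cons_of_mem _ (List.mem_of_mem_head? hy))
    omega
  · rcases List.mem_cons.1 hy with rfl | hy
    · exact (inv.expanded_head y (by simp) a ha (by simp)).mono hsub
    · exact (inv.expanded y hy a ha).mono hsub
  · rw [Option.mem_def] at hy
    rw [hy] at hna
    exact absurd (((horder y.state).2 a).2 ha) hna
  · rw [hlen]
    exact inv.path_length_lt z ((hmem z).1 hz)
  · rw [hlen]
    exact inv.length_le_card

theorem applicable (horder : IsActionOrder T order) {x : Node T} {a : T.Act}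
    (inv : SearchInv k Gr order root table closed (x :: queue) (a :: todo)) :
    T.Applicable x.state a := by
  have h := inv.todo_suffix.subset (List.mem_cons_self (a := a) (l := todo))
  exact ((horder x.state).2 a).1 (by simpa using h)

theorem prune {x : Node T} {a : T.Act}
    (inv : SearchInv k Gr order root table closed (x :: queue) (a :: todo))
    (h : newTuples T k x.state (T.succ x.state a) ⊆ table) :
    SearchInv k Gr order root table closed (x :: queue) todo where
  root_mem := inv.root_mem
  valid := inv.valid
  notMem := inv.notMem
  tuples_subset := inv.tuples_subset
  table_subset := inv.table_subset
  exists_of_mem_table := inv.exists_of_mem_table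
  sorted := inv.sorted
  length_le_head := inv.length_le_head
  expanded := inv.expanded
  expanded_head := by
    intro y hy b hb hnb
    obtain rfl : x = y := by simpa using hy
    by_cases hab : b = a
    · subst hab
      intro t ht
      -- Tuples inherited from the parent are covered by the parent itself; the new ones are in the
      -- table, hence true in some kept node.
      by_cases htx : t ⊆ x.state
      · exact ⟨x, by simp, htx, by omega⟩
      · obtain ⟨z, hz, htz⟩ := inv.exists_of_mem_table t
          (h (mem_newTuples.2 ⟨mem_tuples.1 ht, htx⟩))
        exact ⟨z, hz, htz, inv.length_le_succ z hz⟩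
    · exact inv.expanded_head x (by simp) b hb (by simp [hab, hnb])
  todo_suffix := (List.suffix_cons a todo).trans inv.todo_suffix
  path_length_lt := inv.path_length_lt
  length_le_card := inv.length_le_card

theorem card_lt_card_union {x : Node T} {a : T.Act}
    (h : ¬ newTuples T k x.state (T.succ x.state a) ⊆ table) :
    table.card < (table ∪ newTuples T k x.state (T.succ x.state a)).card := by
  refine Finset.card_lt_card ⟨Finset.subset_union_left, fun h' => h ?_⟩
  exact Finset.subset_union_right.trans h'

theorem union_subset {x : Node T} {a : T.Act} (h : table ⊆ allTuples T k) :
    table ∪ newTuples T k x.state (T.succ x.state a) ⊆ allTuples T k :=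
  Finset.union_subset h ((newTuples_subset_tuples _ _ _).trans (tuples_subset_allTuples _ _))

theorem insert (horder : IsActionOrder T order) {x : Node T} {a : T.Act}
    (inv : SearchInv k Gr order root table closed (x :: queue) (a :: todo))
    (h : ¬ newTuples T k x.state (T.succ x.state a) ⊆ table) (hG : T.succ x.state a ∉ Gr) :
    SearchInv k Gr order root (table ∪ newTuples T k x.state (T.succ x.state a)) closed
      (x :: (queue ++ [⟨T.succ x.state a, a :: x.path⟩])) todo := by
  set y : Node T := ⟨T.succ x.state a, a :: x.path⟩ with hy
  have hylen : y.path.length = x.path.length + 1 := rfl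
  have hmem : ∀ z, z ∈ closed ++ x :: (queue ++ [y]) ↔ z ∈ closed ++ x :: queue ∨ z = y := by
    intro z
    simp only [List.mem_append, List.mem_cons, List.not_mem_nil, or_false]
    tauto
  have hsub : closed ++ x :: queue ⊆ closed ++ x :: (queue ++ [y]) :=
    fun z hz => (hmem z).2 (Or.inl hz)
  have hymem : y ∈ closed ++ x :: (queue ++ [y]) := (hmem y).2 (Or.inr rfl)
  have hcard := card_lt_card_union h
  have hx : x ∈ closed ++ x :: queue := by simp
  refine ⟨hsub inv.root_mem, fun z hz => ?_, fun z hz => ?_, fun z hz => ?_,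
    union_subset inv.table_subset, fun t ht => ?_, ?_, fun w hw z hz => ?_,
    fun z hz b hb => (inv.expanded z hz b hb).mono hsub,
    fun w hw b hb hnb => ?_, ?_, fun z hz => ?_, ?_⟩
  · rcases (hmem z).1 hz with hz | rfl
    · exact inv.valid z hz
    · rw [hy]
      simp only [List.reverse_cons]
      exact Task.exec_concat (inv.valid x hx) (inv.applicable horder)
  · rcases (hmem z).1 hz with hz | rfl
    · exact inv.notMem z hz
    · exact hG
  · rcases (hmem z).1 hz with hz | rfl
    · exact (inv.tuples_subset z hz).trans Finset.subset_union_left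
    · intro t ht
      by_cases htx : t ⊆ x.state
      · exact Finset.mem_union_left _
          (inv.tuples_subset x hx (mem_tuples.2 ⟨htx, (mem_tuples.1 ht).2⟩))
      · exact Finset.mem_union_right _ (mem_newTuples.2 ⟨mem_tuples.1 ht, htx⟩)
  · rcases Finset.mem_union.1 ht with ht | ht
    · obtain ⟨z, hz, htz⟩ := inv.exists_of_mem_table t ht
      exact ⟨z, hsub hz, htz⟩
    · exact ⟨y, hymem, (mem_newTuples.1 ht).1.1⟩
  · have : closed.reverse ++ x :: (queue ++ [y]) = (closed.reverse ++ x :: queue) ++ [y] := by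
      simp
    rw [this, List.pairwise_append]
    refine ⟨inv.sorted, by simp, fun z hz w hw => ?_⟩
    obtain rfl : w = y := by simpa using hw
    rw [hylen]
    exact inv.length_le_succ z (by simpa using hz)
  · obtain rfl : x = w := by simpa using hw
    rcases (hmem z).1 (List.mem_append_right _ hz) with hz | rfl
    · exact inv.length_le_succ z hz
    · exact hylen.le
  · obtain rfl : x = w := by simpa using hw
    by_cases hab : b = a
    · subst hab
      exact fun t ht => ⟨y, hymem, (mem_tuples.1 ht).1, hylen.le⟩
    · exact (inv.expanded_head x (by simp) b hb (by simp [hab, hnb])).mono hsub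
  · have := (List.suffix_cons a todo).trans inv.todo_suffix
    simpa using this
  · have hlx := inv.path_length_lt x hx
    simp only [List.length_cons, List.length_append, List.length_nil] at hlx ⊢
    rcases (hmem z).1 hz with hz | rfl
    · have := inv.path_length_lt z hz
      simp only [List.length_cons] at this
      omega
    · omega
  · have := inv.length_le_card
    simp only [List.length_cons, List.length_append, List.length_nil] at this ⊢
    omega

end SearchInv

/-- An upper bound for the time that remains in an `IW(k)` search, if no state has more than `b`
applicable actions, a state is generated and its tuples are looked up in time `w`, and its
features are evaluated in time `E`. -/
def searchPotential (k b w E : ℕ) (table : Finset (Finset T.Atom)) (queue : List (Node T))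
    (todo : List T.Act) : ℕ :=
  todo.length * w + queue.length + (queue.length - 1) * (b * w) +
    ((allTuples T k).card - table.card) * (E + b * w + 1) + (allTuples T k).card

/-- Bounds for the cost of single operations in the part of the state model reachable from
`root`. -/
structure CostBound (T : Task D) (k : ℕ) (order : T.State → List T.Act) (root : T.State)
    (e : T.State → ℕ) (b w E : ℕ) : Prop where
  order_le : ∀ s, T.Reachable root s → (order s).length ≤ b
  newTuples_le : ∀ s a, 1 + (newTuples T k s (T.succ s a)).card ≤ w
  eval_le : ∀ s, e s ≤ E

/-- Amortized analysis. In the potential, `todo` pays for the remaining children of the head, each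
other queued node holds `b * w` for its future children, and every queued node holds one unit for
its removal. Each tuple still missing from the table holds `E + b * w + 1`, enough to evaluate and
enqueue the node that will supply it. The last summand pays for copying the final path to the plan.
-/
theorem SearchInv.step {k : ℕ} {G : T.State → Set T.State} {order : T.State → List T.Act}
    (horder : IsActionOrder T order) {root : T.State}
    {m : ℕ} {t : ℕ → Finset T.Atom} (ht : T.AdmissibleChainFor root (G root) k m t)
    {table : Finset (Finset T.Atom)} {closed queue : List (Node T)} {todo : List T.Act}
    (inv : SearchInv k (G root) order root table closed queue todo) (plan : List T.Act) :
    (∃ table' closed' queue' todo',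
      step T k G order (.search plan root table closed queue todo) =
        .search plan root table' closed' queue' todo' ∧
      SearchInv k (G root) order root table' closed' queue' todo' ∧
      ∀ e b w E, CostBound T k order root e b w E →
        stepTime T k G e (.search plan root table closed queue todo) +
          searchPotential k b w E table' queue' todo' ≤ searchPotential k b w E table queue todo) ∨
    (∃ s' π, step T k G order (.search plan root table closed queue todo) =
        .start (plan ++ π) s' ∧ T.exec root π = some s' ∧ s' ∈ G root ∧ π.length ≤ m ∧
      π.length ≤ (allTuples T k).card ∧
      ∀ e b w E, CostBound T k order root e b w E →
        stepTime T k G e (.search plan root table closed queue todo) ≤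
          searchPotential k b w E table queue todo) := by
  classical
  obtain _ | ⟨x, queue⟩ := queue
  · obtain ⟨y, hy, -⟩ := inv.exists_mem_queue ht
    simp at hy
  have hx : x ∈ closed ++ x :: queue := by simp
  obtain _ | ⟨a, todo⟩ := todo
  · refine Or.inl ⟨_, _, _, _, by rw [Planning.step], inv.close horder, fun e b w E hc => ?_⟩
    obtain _ | ⟨y, queue⟩ := queue
    · simp [stepTime, searchPotential]
      omega
    · have hb : (order y.state).length ≤ b :=
        hc.order_le _ ⟨_, inv.valid y (by simp)⟩
      have := Nat.mul_le_mul_right w hb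
      simp [stepTime, searchPotential, Nat.add_mul]
      omega
  · have hcard := Finset.card_le_card inv.table_subset
    by_cases h1 : newTuples T k x.state (T.succ x.state a) ⊆ table
    · refine Or.inl ⟨table, closed, x :: queue, todo, ?_, inv.prune h1, fun e b w E hc => ?_⟩
      · rw [Planning.step]
        simp only [h1, if_true]
      · have := hc.newTuples_le x.state a
        simp only [stepTime, searchPotential, h1, if_true, List.length_cons, Nat.add_mul]
        omega
    · have hlt := SearchInv.card_lt_card_union h1
      have hle := Finset.card_le_card (SearchInv.union_subset (x := x) (a := a) inv.table_subset)
      by_cases h2 : T.succ x.state a ∈ G root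
      · have hlen := inv.path_length_lt x hx
        have hlen' := inv.length_le_card
        refine Or.inr ⟨T.succ x.state a, (a :: x.path).reverse, ?_, ?_, h2, ?_, ?_,
          fun e b w E hc => ?_⟩
        · rw [Planning.step]
          simp only [h1, if_false, h2, if_true]
        · rw [List.reverse_cons]
          exact Task.exec_concat (inv.valid x hx) (inv.applicable horder)
        · have := inv.head_length_lt ht
          simpa using this
        · rw [List.length_reverse, List.length_cons]
          omega
        · have hw := hc.newTuples_le x.state a
          have he := hc.eval_le (T.succ x.state a)
          -- The found state brings a fresh tuple, so the table is not yet full and one missing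
          -- tuple pays for the evaluation.
          have hmul : E + b * w + 1 ≤
              ((allTuples T k).card - table.card) * (E + b * w + 1) :=
            Nat.le_mul_of_pos_left _ (by omega)
          have hmul' : w ≤ (todo.length + 1) * w := Nat.le_mul_of_pos_left _ (by omega)
          simp only [stepTime, searchPotential, h1, if_false, h2, if_true, List.length_cons]
            at hlen hlen' ⊢
          omega
      · refine Or.inl ⟨_, closed, _, todo, ?_, inv.insert horder h1 h2, fun e b w E hc => ?_⟩
        · rw [Planning.step]
          simp only [h1, if_false, h2]
        · have hw := hc.newTuples_le x.state a
          have he := hc.eval_le (T.succ x.state a)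
          set table' := table ∪ newTuples T k x.state (T.succ x.state a)
          have hmul : ((allTuples T k).card - table'.card + 1) * (E + b * w + 1) ≤
              ((allTuples T k).card - table.card) * (E + b * w + 1) :=
            Nat.mul_le_mul_right _ (by omega)
          simp only [stepTime, searchPotential, h1, if_false, h2, List.length_cons,
            List.length_append, List.length_nil, Nat.add_sub_cancel, Nat.add_mul, one_mul,
            zero_add, add_zero] at *
          omega

/-- The time of the first `n` transitions from a configuration. -/
noncomputable def runTime (T : Task D) (k : ℕ) (G : T.State → Set T.State)
    (order : T.State → List T.Act) (e : T.State → ℕ) (c : Config T) (n : ℕ) : ℕ :=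
  ∑ i ∈ Finset.range n, stepTime T k G e ((step T k G order)^[i] c)

theorem runTime_add (k : ℕ) (G : T.State → Set T.State) (order : T.State → List T.Act)
    (e : T.State → ℕ) (c : Config T) (m n : ℕ) :
    runTime T k G order e c (m + n) =
      runTime T k G order e c m + runTime T k G order e ((step T k G order)^[m] c) n := by
  simp only [runTime, Finset.sum_range_add]
  congr 1
  refine Finset.sum_congr rfl fun i _ => ?_
  rw [add_comm, Function.iterate_add_apply]

theorem runTime_one (k : ℕ) (G : T.State → Set T.State) (order : T.State → List T.Act)
    (e : T.State → ℕ) (c : Config T) :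
    runTime T k G order e c 1 = stepTime T k G e c := by
  simp [runTime]

theorem runTime_succ (k : ℕ) (G : T.State → Set T.State) (order : T.State → List T.Act)
    (e : T.State → ℕ) (c : Config T) (n : ℕ) :
    runTime T k G order e c (n + 1) =
      stepTime T k G e c + runTime T k G order e (step T k G order c) n := by
  rw [add_comm, runTime_add, runTime_one]
  rfl

theorem one_le_stepTime_search (k : ℕ) (G : T.State → Set T.State) (e : T.State → ℕ)
    (plan : List T.Act) (root : T.State) (table : Finset (Finset T.Atom))
    (closed queue : List (Node T)) (todo : List T.Act) :
    1 ≤ stepTime T k G e (.search plan root table closed queue todo) := by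
  rcases queue with _ | ⟨x, queue⟩ <;> rcases todo with _ | ⟨a, todo⟩ <;> simp [stepTime]
  omega

theorem SearchInv.space_le {k : ℕ} {Gr : Set T.State} {order : T.State → List T.Act}
    {root : T.State} {table : Finset (Finset T.Atom)} {closed queue : List (Node T)}
    {todo : List T.Act} (inv : SearchInv k Gr order root table closed queue todo) {b : ℕ}
    (hb : ∀ s, T.Reachable root s → (order s).length ≤ b) (plan : List T.Act) :
    space T (.search plan root table closed queue todo) ≤
      plan.length + (2 * (allTuples T k).card + b + 1) := by
  have h1 := Finset.card_le_card inv.table_subset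
  have h2 := inv.length_le_card
  have h3 := inv.todo_suffix.length_le
  have h4 : ((queue.head?.map fun y => order y.state).getD []).length ≤ b := by
    rcases queue with _ | ⟨x, queue⟩
    · simp
    · simpa using hb _ ⟨_, inv.valid x (by simp)⟩
  simp only [space]
  omega

/-- A search for which there is an admissible chain ends with a subgoal state that is not farther
away than the chain is long. -/
theorem SearchInv.run {k : ℕ} {G : T.State → Set T.State} {order : T.State → List T.Act}
    (horder : IsActionOrder T order) {root : T.State}
    {m : ℕ} {t : ℕ → Finset T.Atom} (ht : T.AdmissibleChainFor root (G root) k m t)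
    {b₀ w₀ : ℕ} (h₀ : CostBound T k order root (fun _ => 0) b₀ w₀ 0)
    (plan : List T.Act) {table : Finset (Finset T.Atom)} {closed queue : List (Node T)}
    {todo : List T.Act} (inv : SearchInv k (G root) order root table closed queue todo) :
    ∃ n s' π, (Planning.step T k G order)^[n] (.search plan root table closed queue todo) =
        .start (plan ++ π) s' ∧ T.exec root π = some s' ∧ s' ∈ G root ∧ π.length ≤ m ∧
      π.length ≤ (allTuples T k).card ∧
      ∀ e b w E, CostBound T k order root e b w E →
        runTime T k G order e (.search plan root table closed queue todo) n ≤
          searchPotential k b w E table queue todo ∧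
        ∀ i ≤ n, space T ((Planning.step T k G order)^[i]
            (.search plan root table closed queue todo)) ≤
          plan.length + (2 * (allTuples T k).card + b + 1) := by
  -- Every search transition costs at least one unit, so even with free evaluations the potential
  -- strictly decreases. The bounds `b₀`, `w₀` serve only for termination.
  induction hμ : searchPotential k b₀ w₀ 0 table queue todo using Nat.strong_induction_on
    generalizing table closed queue todo with
  | _ μ ih =>
    subst hμ
    rcases inv.step horder ht plan with ⟨table', closed', queue', todo', hs, inv', htime⟩ |
      ⟨s', π, hs, hex, hG, hm, hK, htime⟩
    · have h1 := htime _ _ _ _ h₀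
      have h2 := one_le_stepTime_search k G (fun _ => 0) plan root table closed queue todo
      obtain ⟨n, s', π, hn, hex, hG, hm, hK, hrun⟩ := ih _ (by omega) inv' rfl
      refine ⟨n + 1, s', π, ?_, hex, hG, hm, hK, fun e b w E hc => ?_⟩
      · rw [Function.iterate_succ_apply, hs, hn]
      · obtain ⟨h3, h4⟩ := hrun e b w E hc
        refine ⟨?_, fun i hi => ?_⟩
        · rw [runTime_succ, hs]
          exact (Nat.add_le_add_left h3 _).trans (htime e b w E hc)
        · rcases i with _ | i
          · exact inv.space_le hc.order_le plan
          · rw [Function.iterate_succ_apply, hs]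
            exact h4 i (by omega)
    · refine ⟨1, s', π, hs, hex, hG, hm, hK, fun e b w E hc => ⟨?_, fun i hi => ?_⟩⟩
      · rw [runTime_one]
        exact htime e b w E hc
      · obtain rfl | rfl : i = 0 ∨ i = 1 := by omega
        · exact inv.space_le hc.order_le plan
        · rw [Function.iterate_one, hs]
          simp only [space, List.length_append]
          omega

end search

end Planning

namespace Planning

variable {D : Domain}

/-! ### Cost of one iteration -/

section order

variable {T : Task D}

theorem IsActionOrder.length_eq {order : T.State → List T.Act} (horder : IsActionOrder T order)
    (s : T.State) : (order s).length = Set.ncard {a | T.Applicable s a} := by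
  classical
  have : {a | T.Applicable s a} = ((order s).toFinset : Set T.Act) := by
    ext a
    simp [(horder s).2 a]
  rw [this, Set.ncard_coe_finset, List.toFinset_card_of_nodup (horder s).1]

theorem CostBound.of_branchingLE {order : T.State → List T.Act} (horder : IsActionOrder T order)
    {k b E : ℕ} {root : T.State} {e : T.State → ℕ} (hb : T.BranchingLE root b)
    (he : ∀ s, e s ≤ E) :
    CostBound T k order root e b (1 + effectSize D * (T.numAtoms + 1) ^ (k - 1)) E where
  order_le s hs := (horder.length_eq s).trans_le (hb s hs)
  newTuples_le s a := Nat.add_le_add_left (card_newTuples_succ_le k s a) 1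
  eval_le := he

theorem CostBound.exists (k : ℕ) {order : T.State → List T.Act} (horder : IsActionOrder T order)
    (root : T.State) : ∃ b w, CostBound T k order root (fun _ => 0) b w 0 := by
  classical
  refine ⟨_, _, of_branchingLE horder (b := Nat.card T.Act) (fun s _ => ?_) fun _ => le_rfl⟩
  exact Set.ncard_le_card _

theorem CostBound.of_reachable {order : T.State → List T.Act} {k b w E : ℕ}
    {root s : T.State} {e : T.State → ℕ} (h : CostBound T k order root e b w E)
    (hs : T.Reachable root s) : CostBound T k order s e b w E :=
  ⟨fun s' hs' => h.order_le s' (hs.trans hs'), h.newTuples_le, h.eval_le⟩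

variable (T) in
/-- An upper bound for the time of one iteration of `SIW_R(k)`. -/
def iterationBound (k b w E : ℕ) : ℕ :=
  1 + E + (allTuples T k).card +
    (b * w + 1 + (allTuples T k).card * (E + b * w + 1) + (allTuples T k).card)

theorem stepTime_start_le {k : ℕ} {G : T.State → Set T.State} {order : T.State → List T.Act}
    {root : T.State} {e : T.State → ℕ} {b w E : ℕ} (hc : CostBound T k order root e b w E)
    (plan : List T.Act) (s : T.State) :
    stepTime T k G e (.start plan s) ≤ 1 + E + (allTuples T k).card := by
  have h1 := hc.eval_le s
  have h2 := Finset.card_le_card (tuples_subset_allTuples k s)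
  simp only [stepTime]
  omega

theorem exists_iteration {k : ℕ} {G : T.State → Set T.State} {order : T.State → List T.Act}
    (horder : IsActionOrder T order) {root : T.State} (hgoal : root ∉ T.goalStates)
    (hG : root ∉ G root) {m : ℕ} {t : ℕ → Finset T.Atom}
    (ht : T.AdmissibleChainFor root (G root) k m t) (plan : List T.Act) :
    ∃ n s' π, (step T k G order)^[n] (.start plan root) = .start (plan ++ π) s' ∧
      T.exec root π = some s' ∧ s' ∈ G root ∧ π.length ≤ m ∧
      π.length ≤ (allTuples T k).card ∧
      ∀ e b w E, CostBound T k order root e b w E →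
        runTime T k G order e (.start plan root) n ≤ iterationBound T k b w E ∧
        ∀ i ≤ n, space T ((step T k G order)^[i] (.start plan root)) ≤
          plan.length + (2 * (allTuples T k).card + b + 1) := by
  obtain ⟨b₀, w₀, h₀⟩ := CostBound.exists k horder root
  have inv := searchInv_init (k := k) horder hG
  obtain ⟨n, s', π, hn, hex, hs', hm, hK, hrun⟩ := inv.run horder ht h₀ plan
  have hstep : step T k G order (.start plan root) =
      .search plan root (tuples T k root) [] [⟨root, []⟩] (order root) := by
    rw [step]
    simp only [hgoal, hG, if_false]
  refine ⟨n + 1, s', π, ?_, hex, hs', hm, hK, fun e b w E hc => ?_⟩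
  · rw [Function.iterate_succ_apply, hstep, hn]
  · obtain ⟨h1, h2⟩ := hrun e b w E hc
    refine ⟨?_, fun i hi => ?_⟩
    · rw [runTime_succ, hstep]
      have h3 := stepTime_start_le (G := G) hc plan root
      have h4 := Nat.mul_le_mul_right w (hc.order_le root (.refl root))
      have h5 : ((allTuples T k).card - (tuples T k root).card) * (E + b * w + 1) ≤
          (allTuples T k).card * (E + b * w + 1) :=
        Nat.mul_le_mul_right _ (Nat.sub_le _ _)
      simp only [searchPotential, List.length_singleton, Nat.sub_self, zero_mul] at h1
      simp only [iterationBound]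
      omega
    · rcases i with _ | i
      · simp only [Function.iterate_zero, id, space]
        omega
      · rw [Function.iterate_succ_apply, hstep]
        exact h2 i (by omega)

end order

/-! ### Feature valuations and the number of searches -/

section features

variable {Φ : Features D}

theorem Rule.Satisfied.of_eq {r : Rule Φ} {T : Task D} {s s₁ s₂ : T.State}
    (h : r.Satisfied T s s₁) (hb : ∀ p, Φ.bval p T s₂ = Φ.bval p T s₁)
    (hn : ∀ n, Φ.nval n T s₂ = Φ.nval n T s₁) : r.Satisfied T s s₂ := by
  refine ⟨h.1, fun x hx => ?_, fun p => by rw [hb]; exact h.2.2.1 p,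
    fun n => by rw [hn]; exact h.2.2.2 n⟩
  have := h.2.1 x hx
  cases x <;> simp only [Effect.Holds, hb, hn] at this ⊢ <;> exact this

/-- The feature valuation of a state. -/
def valuation (Φ : Features D) (T : Task D) (s : T.State) :
    (Φ.BoolF → Bool) × (Φ.NumF → ℕ) :=
  (fun p => Φ.bval p T s, fun n => Φ.nval n T s)

theorem mem_subgoals_of_valuation_eq {R : Sketch Φ} {T : Task D} {s s₁ s₂ : T.State}
    (h : s₁ ∈ subgoals R T s) (hs₁ : s₁ ∉ T.goalStates)
    (hv : valuation Φ T s₂ = valuation Φ T s₁) : s₂ ∈ subgoals R T s := by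
  obtain h | ⟨r, hr, hsat⟩ := h
  · exact absurd h hs₁
  · exact Or.inr ⟨r, hr, hsat.of_eq (fun p => congrFun (congrArg Prod.fst hv) p)
      fun n => congrFun (congrArg Prod.snd hv) n⟩

/-- `s 0, …, s j` is a sequence of reachable states, all but possibly the last one not goal
states, in which every state is a subgoal of the one before it. -/
structure IsSubgoalSeq (R : Sketch Φ) (P : Instance D) (j : ℕ) (s : ℕ → P.task.State) :
    Prop where
  reachable : ∀ i ≤ j, P.task.Reachable P.start (s i)
  not_goal : ∀ i < j, s i ∉ P.task.goalStates
  mem_subgoals : ∀ i < j, s (i + 1) ∈ subgoals R P.task (s i)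

variable {R : Sketch Φ} {P : Instance D} {Q : Set (Instance D)}

theorem IsSubgoalSeq.snoc {j : ℕ} {s : ℕ → P.task.State} (h : IsSubgoalSeq R P j s)
    {s' : P.task.State} (hr : P.task.Reachable P.start s') (hg : s j ∉ P.task.goalStates)
    (hs : s' ∈ subgoals R P.task (s j)) :
    IsSubgoalSeq R P (j + 1) fun i => if i ≤ j then s i else s' := by
  refine ⟨fun i hi => ?_, fun i hi => ?_, fun i hi => ?_⟩
  · by_cases hij : i ≤ j
    · simpa only [hij, if_true] using h.reachable i hij
    · simpa only [hij, if_false] using hr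
  · have hij : i ≤ j := by omega
    simp only [hij, if_true]
    rcases hij.lt_or_eq with hlt | rfl
    · exact h.not_goal i hlt
    · exact hg
  · have hij : i ≤ j := by omega
    rcases hij.lt_or_eq with hlt | rfl
    · have : i + 1 ≤ j := hlt
      simpa only [hij, this, if_true] using h.mem_subgoals i hlt
    · simpa using hs

/-- The constant sequence `s, s` would be a cycle. This excludes the self-loop of `step` at a
`start` configuration. -/
theorem StateAcyclic.notMem_subgoals (hac : StateAcyclic R Q) (hP : P ∈ Q)
    {s : P.task.State} (hr : P.task.Reachable P.start s) (hg : s ∉ P.task.goalStates) :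
    s ∉ subgoals R P.task s := fun hs =>
  hac P hP ⟨1, fun _ => s, fun _ _ => hr, fun _ _ => hg, fun _ _ => hs, 0, by omega, rfl⟩

/-- The non-goal states of a sequence of subgoals differ in their feature valuations. -/
theorem IsSubgoalSeq.injOn_valuation (hac : StateAcyclic R Q) (hP : P ∈ Q) {j : ℕ}
    {s : ℕ → P.task.State} (h : IsSubgoalSeq R P j s) :
    Set.InjOn (fun i => valuation Φ P.task (s i)) (Set.Iio j) := by
  have key : ∀ i l, i < l → l < j →
      valuation Φ P.task (s i) ≠ valuation Φ P.task (s l) := by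
    intro i l hil hlj hv
    -- Cycle: `s i, …, s (l - 1)`, then back to `s i` in place of `s l`. The last step is legitimate
    -- because `s l` is not a goal state, so a rule put it among the subgoals, and rules see only
    -- valuations.
    refine hac P hP ⟨l - i, fun r => if i + r < l then s (i + r) else s i, fun r _ => ?_,
      fun r _ => ?_, fun r hr => ?_, 0, by omega, ?_⟩
    · dsimp only
      split_ifs <;> exact h.reachable _ (by omega)
    · dsimp only
      split_ifs <;> exact h.not_goal _ (by omega)
    · have hm := h.mem_subgoals (i + r) (by omega)
      have h1 : i + r < l := by omega
      by_cases h2 : i + (r + 1) < l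
      · simp only [h1, h2, if_true]
        exact hm
      · simp only [h1, h2, if_true, if_false]
        have h3 : i + r + 1 = l := by omega
        rw [h3] at hm
        exact mem_subgoals_of_valuation_eq hm (h.not_goal l hlj) hv
    · have h1 : ¬ i + (l - i) < l := by omega
      simp only [h1, if_false, add_zero, ite_self]
  intro i hi l hl hv
  rcases lt_trichotomy i l with hlt | heq | hgt
  · exact absurd hv (key i l hlt hl)
  · exact heq
  · exact absurd hv.symm (key l i hgt hi)

/-- A crude bound that makes the algorithm terminate without any assumption on the number of feature
values. -/
theorem IsSubgoalSeq.length_le_card (hac : StateAcyclic R Q) (hP : P ∈ Q) {j : ℕ}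
    {s : ℕ → P.task.State} (h : IsSubgoalSeq R P j s) : j ≤ Fintype.card P.task.State := by
  have hinj : Set.InjOn s (Finset.range j) := by
    intro i hi l hl he
    exact h.injOn_valuation hac hP (by simpa using hi) (by simpa using hl)
      (congrArg (valuation Φ P.task) he)
  have := Finset.card_le_card_of_injOn (t := Finset.univ) s (fun _ _ => Finset.mem_univ _) hinj
  simpa using this

theorem IsSubgoalSeq.length_le (hac : StateAcyclic R Q) (hP : P ∈ Q) {j : ℕ}
    {s : ℕ → P.task.State} (h : IsSubgoalSeq R P j s) {c : ℕ}
    (hc : Φ.LinearlyManyValues c P) :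
    j ≤ 2 ^ Fintype.card Φ.BoolF * (c * P.task.numAtoms) ^ Fintype.card Φ.NumF := by
  classical
  have hfin : ∀ n, (Φ.nval n P.task '' {s | P.task.Reachable P.start s}).Finite := fun n =>
    Set.toFinite _
  have hinj : Set.InjOn (fun i => valuation Φ P.task (s i)) (Finset.range j) := by
    intro i hi l hl he
    exact h.injOn_valuation hac hP (by simpa using hi) (by simpa using hl) he
  have hcard := Finset.card_le_card_of_injOn
    (t := (Finset.univ : Finset (Φ.BoolF → Bool)) ×ˢ
      Fintype.piFinset fun n => (hfin n).toFinset) (fun i => valuation Φ P.task (s i))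
    (fun i hi => by
      have hi : i < j := by simpa using hi
      simp only [Finset.coe_product, Set.mem_prod, Finset.mem_coe, Finset.mem_univ, true_and,
        Fintype.mem_piFinset, Set.Finite.mem_toFinset]
      exact fun n => ⟨s i, h.reachable i hi.le, rfl⟩) hinj
  rw [Finset.card_range, Finset.card_product, Finset.card_univ, Fintype.card_fun,
    Fintype.card_bool, Fintype.card_piFinset] at hcard
  refine hcard.trans (Nat.mul_le_mul_left _ ?_)
  refine (Finset.prod_le_pow_card _ _ (c * P.task.numAtoms) fun n _ => ?_)
  have := hc n
  rw [(hfin n).encard_eq_coe_toFinset_card] at this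
  exact_mod_cast this

end features

/-! ### The sequence of searches -/

section siw

variable {Φ : Features D} {R : Sketch Φ} {Q : Set (Instance D)} {k : ℕ} {P : Instance D}
  {order : P.task.State → List P.task.Act}

variable (R k P order) in
/-- `SIW_R(k)` on `P` starts searches from `s 0, …, s (j - 1)` and arrives in `s j`, within the
given bounds of time and space. -/
def HasTrace (j : ℕ) (s : ℕ → P.task.State) : Prop :=
  IsSubgoalSeq R P j s ∧ P.task.Solvable (s j) ∧
  ∃ n plan, siw R k P order n = .start plan (s j) ∧ P.task.exec P.start plan = some (s j) ∧
    plan.length ≤ j * (allTuples P.task k).card ∧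
    ∀ e b w E, CostBound P.task k order P.start e b w E →
      siwTime R k P order e n ≤ j * iterationBound P.task k b w E ∧
      ∀ i ≤ n, space P.task (siw R k P order i) ≤
        j * (allTuples P.task k).card + (2 * (allTuples P.task k).card + b + 1)

theorem hasTrace_zero (hsol : P.task.Solvable P.start) :
    HasTrace R k P order 0 fun _ => P.start := by
  refine ⟨⟨fun _ _ => .refl _, by simp, by simp⟩, hsol, 0, [], rfl, by simp [Task.exec],
    by simp, fun e b w E _ => ⟨by simp [siwTime], fun i hi => ?_⟩⟩
  obtain rfl : i = 0 := by omega
  simp [siw, space]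

theorem HasTrace.exists_succ (hclosed : ClosedClass Q) (hwidth : SketchSWidthLE R Q k)
    (hac : StateAcyclic R Q) (hP : P ∈ Q) (horder : IsActionOrder P.task order) {j : ℕ}
    {s : ℕ → P.task.State} (h : HasTrace R k P order j s) (hg : s j ∉ P.task.goalStates) :
    ∃ s', HasTrace R k P order (j + 1) s' := by
  obtain ⟨hseq, hsol, n, plan, hn, hex, hlen, hcost⟩ := h
  have hreach := hseq.reachable j le_rfl
  obtain ⟨hw, hdead⟩ := hwidth _ (hclosed P hP (s j) hreach hsol)
  obtain ⟨t, ht⟩ := hw.exists_shortest (G' := subgoals R P.task (s j)) fun _ hs => hs.1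
  obtain ⟨n', s', π, hn', hex', hs', hm, hK, hcost'⟩ := exists_iteration (k := k)
    (G := subgoals R P.task) horder hg (hac.notMem_subgoals hP hreach hg) ht plan
  have hsiw : ∀ i, siw R k P order (i + n) =
      (step P.task k (subgoals R P.task) order)^[i] (.start plan (s j)) := by
    intro i
    rw [← hn, siw, siw, Function.iterate_add_apply]
  refine ⟨_, hseq.snoc (hreach.trans ⟨π, hex'⟩) hg hs', ?_, n' + n, plan ++ π, ?_, ?_, ?_,
    fun e b w E hc => ?_⟩
  -- Here `m` is the length of a shortest chain, so `hm` places the found state among the near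
  -- subgoals, which contain no dead-end.
  · simpa using hdead s' ⟨hs', π, hex', hm⟩
  · rw [hsiw, hn']
    simp
  · simpa using Task.exec_trans hex hex'
  · rw [List.length_append, Nat.succ_mul]
    omega
  · obtain ⟨h1, h2⟩ := hcost e b w E hc
    obtain ⟨h3, h4⟩ := hcost' e b w E (hc.of_reachable hreach)
    refine ⟨?_, fun i hi => ?_⟩
    · have : siwTime R k P order e (n' + n) = siwTime R k P order e n +
          runTime P.task k (subgoals R P.task) order e (.start plan (s j)) n' := by
        rw [← hn, add_comm]
        exact runTime_add _ _ _ _ _ _ _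
      rw [this, Nat.succ_mul]
      omega
    · rw [Nat.succ_mul]
      rcases le_total i n with hin | hin
      · exact (h2 i hin).trans (by omega)
      · obtain ⟨r, rfl⟩ := Nat.exists_eq_add_of_le' hin
        rw [hsiw]
        exact (h4 r (by omega)).trans (by omega)

theorem exists_hasTrace_goal (hclosed : ClosedClass Q) (hwidth : SketchSWidthLE R Q k)
    (hac : StateAcyclic R Q) (hP : P ∈ Q) (horder : IsActionOrder P.task order)
    (hsol : P.task.Solvable P.start) :
    ∃ j s, HasTrace R k P order j s ∧ s j ∈ P.task.goalStates := by
  by_contra! hno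
  have hall : ∀ j, ∃ s, HasTrace R k P order j s := by
    intro j
    induction j with
    | zero => exact ⟨_, hasTrace_zero hsol⟩
    | succ j ih =>
      obtain ⟨s, hs⟩ := ih
      exact hs.exists_succ hclosed hwidth hac hP horder (hno j s hs)
  obtain ⟨s, hs⟩ := hall (Fintype.card P.task.State + 1)
  have := hs.1.length_le_card hac hP
  omega

/-- `SIW_R(k)` halts with a plan; time and space in terms of the number `j` of its searches. -/
theorem siw_halts (hclosed : ClosedClass Q) (hwidth : SketchSWidthLE R Q k)
    (hac : StateAcyclic R Q) (hP : P ∈ Q) (horder : IsActionOrder P.task order)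
    (hsol : P.task.Solvable P.start) :
    ∃ n π j, siw R k P order n = .done π ∧ P.task.IsPlan P.start P.task.goalStates π ∧
      (∀ c, Φ.LinearlyManyValues c P →
        j ≤ 2 ^ Fintype.card Φ.BoolF * (c * P.task.numAtoms) ^ Fintype.card Φ.NumF) ∧
      ∀ e b w E, CostBound P.task k order P.start e b w E →
        siwTime R k P order e n ≤ (j + 1) * iterationBound P.task k b w E ∧
        ∀ i ≤ n, space P.task (siw R k P order i) ≤
          j * (allTuples P.task k).card + (2 * (allTuples P.task k).card + b + 1) := by
  obtain ⟨j, s, ⟨hseq, -, n, plan, hn, hex, hlen, hcost⟩, hg⟩ :=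
    exists_hasTrace_goal hclosed hwidth hac hP horder hsol
  have hdone : siw R k P order (n + 1) = .done plan := by
    have : siw R k P order (n + 1) =
        step P.task k (subgoals R P.task) order (siw R k P order n) :=
      Function.iterate_succ_apply' _ _ _
    rw [this, hn, step]
    simp only [hg, if_true]
  refine ⟨n + 1, plan, j, hdone, ⟨s j, hg, hex⟩, fun c hc => hseq.length_le hac hP hc,
    fun e b w E hc => ?_⟩
  obtain ⟨h1, h2⟩ := hcost e b w E hc
  refine ⟨?_, fun i hi => ?_⟩
  · have h3 := stepTime_start_le (G := subgoals R P.task) hc plan (s j)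
    have h4 : siwTime R k P order e (n + 1) = siwTime R k P order e n +
        stepTime P.task k (subgoals R P.task) e (.start plan (s j)) := by
      rw [← hn]
      exact Finset.sum_range_succ _ _
    have h5 : 1 + E + (allTuples P.task k).card ≤ iterationBound P.task k b w E :=
      Nat.le_add_right _ _
    rw [h4, Nat.succ_mul]
    omega
  · rcases Nat.le_succ_iff.1 hi with hi | rfl
    · exact h2 i hi
    · rw [hdone]
      simp only [space]
      omega

end siw

/-! ### From exact bounds to asymptotic ones -/

section asymptotics

theorem succ_pow_le {N : ℕ} (hN : 1 ≤ N) {i k : ℕ} (hi : i ≤ k) :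
    (N + 1) ^ i ≤ 2 ^ k * N ^ i :=
  calc (N + 1) ^ i ≤ (2 * N) ^ i := Nat.pow_le_pow_left (by omega) i
    _ = 2 ^ i * N ^ i := mul_pow _ _ _
    _ ≤ 2 ^ k * N ^ i := Nat.mul_le_mul_right _ (Nat.pow_le_pow_right (by norm_num) hi)

/-- The constant in the time bound for one iteration. -/
def iterationConst (h k c : ℕ) : ℕ :=
  2 + c + 3 * 2 ^ k + (1 + h) * 2 ^ k + 2 ^ k * c + 2 ^ k * ((1 + h) * 2 ^ k)

theorem iterationBound_le {T : Task D} {k b E c : ℕ} (hk : 1 ≤ k) (hb : 1 ≤ b)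
    (hN : 1 ≤ T.numAtoms) (hE : E * T.numAtoms ^ k ≤ c * (b * T.numAtoms ^ (2 * k - 1))) :
    iterationBound T k b (1 + effectSize D * (T.numAtoms + 1) ^ (k - 1)) E ≤
      iterationConst (effectSize D) k c * (b * T.numAtoms ^ (2 * k - 1)) := by
  have hK : (allTuples T k).card ≤ 2 ^ k * T.numAtoms ^ k :=
    (card_allTuples_le T k).trans (succ_pow_le hN le_rfl)
  have hM : (T.numAtoms + 1) ^ (k - 1) ≤ 2 ^ k * T.numAtoms ^ (k - 1) :=
    succ_pow_le hN (by omega)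
  unfold iterationBound iterationConst
  generalize (allTuples T k).card = K at *
  generalize (T.numAtoms + 1) ^ (k - 1) = M at *
  generalize T.numAtoms = N at *
  generalize effectSize D = h
  have hS : 1 ≤ 2 ^ k := Nat.one_le_two_pow
  have hA : 1 ≤ N ^ (k - 1) := Nat.one_le_pow _ _ hN
  have hB : 1 ≤ N ^ k := Nat.one_le_pow _ _ hN
  have hAB : N ^ (2 * k - 1) = N ^ k * N ^ (k - 1) := by
    rw [← pow_add]
    congr 1
    omega
  rw [hAB] at hE ⊢
  generalize N ^ k = B at *
  generalize N ^ (k - 1) = A at *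
  generalize 2 ^ k = S at *
  -- With `A = N^(k-1)`, `B = N^k`, every summand is compared with `U = b * (B * A)`. The terms `K *
  -- W` (lookups) and `K * E` (evaluations) decide the order.
  have hBU : B ≤ b * (B * A) := by nlinarith [Nat.mul_le_mul hb hA, Nat.le_mul_of_pos_right B hA]
  have hbA : b * A ≤ b * (B * A) := Nat.mul_le_mul_left _ (Nat.le_mul_of_pos_left _ hB)
  have hw : b * (1 + h * M) ≤ (1 + h) * S * (b * A) := by
    calc b * (1 + h * M) ≤ b * (S * A + h * (S * A)) := by
          gcongr
          exact Nat.mul_pos hS hA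
      _ = _ := by ring
  generalize b * (1 + h * M) = W at *
  have hw' : W ≤ (1 + h) * S * (b * (B * A)) := hw.trans (Nat.mul_le_mul_left _ hbA)
  have hKW : K * W ≤ S * ((1 + h) * S) * (b * (B * A)) :=
    (Nat.mul_le_mul hK hw).trans (le_of_eq (by ring))
  have hKE : K * E ≤ S * c * (b * (B * A)) :=
    calc K * E ≤ S * B * E := Nat.mul_le_mul_right _ hK
      _ = S * (E * B) := by ring
      _ ≤ S * (c * (b * (B * A))) := Nat.mul_le_mul_left _ hE
      _ = _ := by ring
  have hE' : E ≤ c * (b * (B * A)) := (Nat.le_mul_of_pos_right _ hB).trans hE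
  have hK' : K ≤ S * (b * (B * A)) := hK.trans (Nat.mul_le_mul_left _ hBU)
  have hU := hB.trans hBU
  generalize b * (B * A) = U at *
  nlinarith

end asymptotics

end Planning

/-! ### The main theorem -/

theorem theorem2 (D : Planning.Domain) (Φ : Planning.Features D) (R : Planning.Sketch Φ)
    (k : ℕ) (hk : 1 ≤ k) (c : ℕ) :
    ∃ C : ℕ, ∀ Q : Set (Planning.Instance D),
      Planning.ClosedClass Q →
      (∀ P ∈ Q, P.task.Solvable P.start) →
      Planning.SketchSWidthLE R Q k →
      Planning.StateAcyclic R Q →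
      ∀ P ∈ Q, ∀ order : P.task.State → List P.task.Act,
        Planning.IsActionOrder P.task order →
        ∃ (n : ℕ) (π : List P.task.Act),
          Planning.siw R k P order n = Planning.Config.done π ∧
          P.task.IsPlan P.start P.task.goalStates π ∧
          ∀ b : ℕ, 1 ≤ b → P.task.BranchingLE P.start b → 1 ≤ P.task.numAtoms →
            Φ.LinearlyManyValues c P →
            -- time, when a feature evaluation and subgoal test of a state is a single operation
            Planning.siwTime R k P order (fun _ => 1) n
              ≤ C * (b * P.task.numAtoms ^ (Φ.card + (2 * k - 1))) ∧
            -- time, when it is charged any cost that is at most linear in the number of atoms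
            (2 ≤ k ∨ P.task.numAtoms ≤ b →
              ∀ e : P.task.State → ℕ, (∀ s, e s ≤ c * P.task.numAtoms) →
                Planning.siwTime R k P order e n
                  ≤ C * (b * P.task.numAtoms ^ (Φ.card + (2 * k - 1)))) ∧
            -- space
            ∀ i ≤ n, Planning.space P.task (Planning.siw R k P order i)
              ≤ C * (b * P.task.numAtoms ^ k + P.task.numAtoms ^ (Φ.card + k)) := by
  set J := 2 ^ Fintype.card Φ.BoolF * c ^ Fintype.card Φ.NumF with hJ
  -- With `c + 1` instead of `c`, one constant serves both unit evaluation cost (also when `c = 0`)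
  -- and cost `c * N`.
  set X := Planning.iterationConst (Planning.effectSize D) k (c + 1) with hX
  refine ⟨(J + 1) * X + (J * 2 ^ k + 2 * 2 ^ k + 2), ?_⟩
  intro Q hclosed hsol hwidth hac P hP order horder
  obtain ⟨n, π, j, hdone, hplan, hj, hcost⟩ :=
    Planning.siw_halts hclosed hwidth hac hP horder (hsol P hP)
  refine ⟨n, π, hdone, hplan, fun b hb hbranch hN hlin => ?_⟩
  have hjN : j ≤ J * P.task.numAtoms ^ Φ.card := by
    refine (hj c hlin).trans ?_
    rw [mul_pow, ← mul_assoc]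
    exact Nat.mul_le_mul_left _ (Nat.pow_le_pow_right hN (Nat.le_add_left _ _))
  have hF : 1 ≤ P.task.numAtoms ^ Φ.card := Nat.one_le_pow _ _ hN
  have htime : ∀ (e : P.task.State → ℕ) (E : ℕ), (∀ s, e s ≤ E) →
      E * P.task.numAtoms ^ k ≤ (c + 1) * (b * P.task.numAtoms ^ (2 * k - 1)) →
      Planning.siwTime R k P order e n ≤
        ((J + 1) * X + (J * 2 ^ k + 2 * 2 ^ k + 2)) *
          (b * P.task.numAtoms ^ (Φ.card + (2 * k - 1))) := by
    intro e E he hE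
    have h1 := (hcost e b _ E (.of_branchingLE horder hbranch he)).1
    have h2 := Planning.iterationBound_le hk hb hN hE
    calc _ ≤ _ := h1
      _ ≤ ((J + 1) * P.task.numAtoms ^ Φ.card) *
          -- `J + 1` rather than `J`: the final `start` configuration, which only detects the goal,
          -- is charged as one more iteration.
          (X * (b * P.task.numAtoms ^ (2 * k - 1))) := Nat.mul_le_mul (by nlinarith) h2
      _ = (J + 1) * X * (b * P.task.numAtoms ^ (Φ.card + (2 * k - 1))) := by
          rw [pow_add]
          ring
      _ ≤ _ := Nat.mul_le_mul_right _ (Nat.le_add_right _ _)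
  refine ⟨?_, fun hor e he => ?_, fun i hi => ?_⟩
  · refine htime _ 1 (fun _ => le_rfl) ?_
    have h1 : P.task.numAtoms ^ k ≤ P.task.numAtoms ^ (2 * k - 1) :=
      Nat.pow_le_pow_right hN (by omega)
    exact Nat.mul_le_mul (by omega) (h1.trans (Nat.le_mul_of_pos_left _ hb))
  · refine htime e _ he ?_
    rw [mul_assoc, ← pow_succ']
    refine Nat.mul_le_mul (Nat.le_succ c) ?_
    -- What remains is `N^(k+1) ≤ b * N^(2k-1)`. It follows from `k + 1 ≤ 2k - 1` if `k ≥ 2`;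
    -- otherwise `b` absorbs one factor `N`.
    rcases hor with hk2 | hNb
    · exact (Nat.pow_le_pow_right hN (by omega)).trans (Nat.le_mul_of_pos_left _ hb)
    · rw [pow_succ']
      exact Nat.mul_le_mul hNb (Nat.pow_le_pow_right hN (by omega))
  · have h1 := (hcost (fun _ => 0) b _ 0 (.of_branchingLE horder hbranch fun _ => le_rfl)).2 i hi
    have hK : (Planning.allTuples P.task k).card ≤ 2 ^ k * P.task.numAtoms ^ k :=
      (Planning.card_allTuples_le P.task k).trans (Planning.succ_pow_le hN le_rfl)
    have hjK := Nat.mul_le_mul hjN hK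
    have hA : 1 ≤ P.task.numAtoms ^ k := Nat.one_le_pow _ _ hN
    have hAb : P.task.numAtoms ^ k ≤ b * P.task.numAtoms ^ k := Nat.le_mul_of_pos_left _ hb
    have hbA : b ≤ b * P.task.numAtoms ^ k := Nat.le_mul_of_pos_right _ hA
    calc _ ≤ _ := h1
      _ ≤ J * P.task.numAtoms ^ Φ.card * (2 ^ k * P.task.numAtoms ^ k) +
          (2 * (2 ^ k * (b * P.task.numAtoms ^ k)) + b * P.task.numAtoms ^ k +
            b * P.task.numAtoms ^ k) := by
          have := hK.trans (Nat.mul_le_mul_left (2 ^ k) hAb)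
          omega
      _ = J * 2 ^ k * P.task.numAtoms ^ (Φ.card + k) +
          (2 * 2 ^ k + 2) * (b * P.task.numAtoms ^ k) := by
          rw [pow_add]
          ring
      _ ≤ ((J + 1) * X + (J * 2 ^ k + 2 * 2 ^ k + 2)) * P.task.numAtoms ^ (Φ.card + k) +
          ((J + 1) * X + (J * 2 ^ k + 2 * 2 ^ k + 2)) * (b * P.task.numAtoms ^ k) :=
          Nat.add_le_add (Nat.mul_le_mul_right _ (by omega))
            (Nat.mul_le_mul_right _ (by omega))
      _ = _ := by ring
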